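/- Let $\mathcal A$ be a locally noetherian Grothendieck category, i.e. a Grothendieck category with a small generating set of noetherian objects. Let $G$ be an arbitrary group acting on $\mathcal A$, i.e. let a group homomorphism be given from $G$ to the group (under composition) of isomorphism classes of autoequivalences of $\mathcal A$. An object $H$ of $\mathcal A$ is monoform if $H\neq 0$ and, for every nonzero subobject $L\subseteq H$, the objects $H$ and $H/L$ have no common nonzero subobject (up to isomorphism). Two monoform objects are atom-equivalent if they have a common nonzero subobject. The atom spectrum $\operatorname{Spec}\mathcal A$ is the set of atom-equivalence classes $\overline H$ of monoform objects $H$, with the topology generated by the sets $$\operatorname{Supp} M=\{\overline H \mid H \text{ a monoform subquotient of } M\},\qquad M\in\mathcal A.$$ The group $G$ acts on $\operatorname{Spec}\mathcal A$ by $g\cdot\overline H=\overline{g\cdot H}$, and the orbit atom spectrum $\operatorname{Spec}^G\mathcal A$ is the quotient space $(\operatorname{Spec}\mathcal A)/G$. Then $\operatorname{Spec}^G\mathcal A$ is a $T_0$-space. By contrast, quotients of $T_0$-spaces by group actions need not be $T_0$: there are a $T_0$-space $X$ and a group acting on $X$ by homeomorphisms such that the orbit space, with the quotient topology, is not a $T_0$-space.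 -/

import Mathlib

open CategoryTheory CategoryTheory.Limits

universe w v u z

namespace OrbitAtom

section Atoms

variable {A : Type u} [Category.{v} A]

/-- `X` and `Y` have a common nonzero subobject: some nonzero object embeds into both. -/
def HasCommonNonzeroSubobject (X Y : A) : Prop :=
  ∃ K : A, ¬ IsZero K ∧ (∃ i : K ⟶ X, Mono i) ∧ (∃ j : K ⟶ Y, Mono j)

/-- `X` is a subquotient of `M`: a quotient of a subobject of `M`. -/
def IsSubquotient (X M : A) : Prop :=
  ∃ (N : A) (i : N ⟶ M) (p : N ⟶ X), Mono i ∧ Epi p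

lemma isZero_of_map {B : Type*} [Category* B] (e : A ≌ B) {X : A}
    (h : IsZero (e.functor.obj X)) : IsZero X := by
  refine ⟨fun Y => ⟨⟨⟨e.functor.preimage (h.to_ _)⟩, fun f => ?_⟩⟩,
    fun Y => ⟨⟨⟨e.functor.preimage (h.from_ _)⟩, fun f => ?_⟩⟩⟩
  · exact e.functor.map_injective (h.eq_of_src _ _)
  · exact e.functor.map_injective (h.eq_of_tgt _ _)

lemma HasCommonNonzeroSubobject.map_equivalence {X Y : A}
    (h : HasCommonNonzeroSubobject X Y) {B : Type*} [Category* B] (e : A ≌ B) :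
    HasCommonNonzeroSubobject (e.functor.obj X) (e.functor.obj Y) := by
  obtain ⟨K, hK, ⟨i, hi⟩, ⟨j, hj⟩⟩ := h
  refine ⟨e.functor.obj K, fun hz => hK ?_, ⟨e.functor.map i, inferInstance⟩,
    ⟨e.functor.map j, inferInstance⟩⟩
  exact isZero_of_map e hz

lemma HasCommonNonzeroSubobject.mono {X Y X' Y' : A}
    (h : HasCommonNonzeroSubobject X Y) (f : X ⟶ X') [Mono f] (g : Y ⟶ Y') [Mono g] :
    HasCommonNonzeroSubobject X' Y' := by
  obtain ⟨K, hK, ⟨i, hi⟩, ⟨j, hj⟩⟩ := h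
  exact ⟨K, hK, ⟨i ≫ f, mono_comp i f⟩, ⟨j ≫ g, mono_comp j g⟩⟩

variable [Abelian A]

/-- `H` is monoform: it is nonzero and, for every nonzero subobject `L` of `H`, the objects
`H` and `H/L` have no common nonzero subobject. -/
def Monoform (H : A) : Prop :=
  ¬ IsZero H ∧ ∀ (L : A) (i : L ⟶ H) [Mono i], ¬ IsZero L →
    ¬ HasCommonNonzeroSubobject H (cokernel i)

/-- Nonzero subobjects of a monoform object meet nontrivially. -/
lemma Monoform.pullback_not_isZero {H K K' : A} (hH : Monoform H) (i : K ⟶ H) (j : K' ⟶ H)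
    [Mono i] [Mono j] (hK : ¬ IsZero K) (hK' : ¬ IsZero K') : ¬ IsZero (pullback i j) := by
  intro hz
  refine hH.2 K' j hK' ⟨K, hK, ⟨i, inferInstance⟩, ⟨i ≫ cokernel.π j, ?_⟩⟩
  refine Preadditive.mono_of_cancel_zero _ fun {P} g hg => ?_
  have hg' : (g ≫ i) ≫ cokernel.π j = 0 := by rw [Category.assoc]; exact hg
  have h1 : g ≫ i = Abelian.monoLift j (g ≫ i) hg' ≫ j := (Abelian.monoLift_comp j _ hg').symm
  rw [← pullback.lift_fst _ _ h1, hz.eq_of_tgt (pullback.lift _ _ h1) 0, zero_comp]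

lemma Monoform.map_equivalence {H : A} (hH : Monoform H) {B : Type*} [Category* B] [Abelian B]
    (e : A ≌ B) : Monoform (e.functor.obj H) := by
  refine ⟨fun hz => hH.1 (isZero_of_map e hz), fun L i _ hL hc => ?_⟩
  let u : e.inverse.obj (e.functor.obj H) ⟶ H := e.unitInv.app H
  refine hH.2 (e.inverse.obj L) (e.inverse.map i ≫ u)
    (fun hz => hL (isZero_of_map e.symm hz)) ?_
  have h1 := hc.map_equivalence e.symm
  exact h1.mono u
    ((PreservesCokernel.iso e.inverse i).hom ≫ (cokernelCompIsIso (e.inverse.map i) u).inv)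

variable (A) in
/-- Atom-equivalence of monoform objects: having a common nonzero subobject. -/
def atomSetoid : Setoid {H : A // Monoform H} where
  r H₁ H₂ := HasCommonNonzeroSubobject H₁.1 H₂.1
  iseqv :=
    { refl := fun H => ⟨H.1, H.2.1, ⟨𝟙 _, inferInstance⟩, ⟨𝟙 _, inferInstance⟩⟩
      symm := fun ⟨K, hK, hi, hj⟩ => ⟨K, hK, hj, hi⟩
      trans := by
        rintro H₁ H₂ H₃ ⟨K, hK, ⟨a, ha⟩, ⟨b, hb⟩⟩ ⟨K', hK', ⟨c, hc⟩, ⟨d, hd⟩⟩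
        exact ⟨pullback b c, H₂.2.pullback_not_isZero b c hK hK',
          ⟨pullback.fst b c ≫ a, mono_comp _ _⟩, ⟨pullback.snd b c ≫ d, mono_comp _ _⟩⟩ }

variable (A) in
/-- The atom spectrum: the set of atom-equivalence classes of monoform objects. -/
def AtomSpectrum : Type u := _root_.Quotient (atomSetoid A)

/-- The atom of a monoform object. -/
def atom (H : A) (hH : Monoform H) : AtomSpectrum A := _root_.Quotient.mk (atomSetoid A) ⟨H, hH⟩

/-- The atom support of `M`: the atoms of the monoform subquotients of `M`. -/
def atomSupport (M : A) : Set (AtomSpectrum A) :=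
  {α | ∃ (H : A) (hH : Monoform H), IsSubquotient H M ∧ atom H hH = α}

/-- The topology on the atom spectrum generated by the atom supports of objects. -/
instance : TopologicalSpace (AtomSpectrum A) :=
  TopologicalSpace.generateFrom (Set.range (atomSupport (A := A)))

end Atoms

section Autoequivalences

variable (A : Type u) [Category.{v} A]

/-- Two autoequivalences are identified when their underlying functors are isomorphic. -/
def autoequivSetoid : Setoid (A ≌ A) where
  r e f := Nonempty (e.functor ≅ f.functor)
  iseqv :=
    { refl := fun _ => ⟨Iso.refl _⟩
      symm := fun ⟨i⟩ => ⟨i.symm⟩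
      trans := fun ⟨i⟩ ⟨j⟩ => ⟨i ≪≫ j⟩ }

/-- The isomorphism classes of autoequivalences of `A`. -/
def AutoequivClass : Type (max u v) := _root_.Quotient (autoequivSetoid A)

variable {A}

/-- The isomorphism class of an autoequivalence. -/
def AutoequivClass.mk (e : A ≌ A) : AutoequivClass A := _root_.Quotient.mk (autoequivSetoid A) e

/-- The group structure is composition: the product of the classes of `e` and `f` is the class
of the autoequivalence that applies first `f` and then `e`. -/
instance : Group (AutoequivClass A) where
  mul := _root_.Quotient.map₂ (fun e f => f.trans e)
    (fun _ _ ⟨i⟩ _ _ ⟨j⟩ => ⟨NatIso.hcomp j i⟩)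
  one := AutoequivClass.mk CategoryTheory.Equivalence.refl
  inv := _root_.Quotient.map (fun e => e.symm)
    (fun e f ⟨i⟩ => ⟨e.toAdjunction.rightAdjointUniq (f.toAdjunction.ofNatIsoLeft i.symm)⟩)
  mul_assoc := by
    rintro ⟨e⟩ ⟨f⟩ ⟨g⟩
    exact _root_.Quotient.sound ⟨(Functor.associator _ _ _).symm⟩
  one_mul := by
    rintro ⟨e⟩
    exact _root_.Quotient.sound ⟨Functor.rightUnitor _⟩
  mul_one := by
    rintro ⟨e⟩
    exact _root_.Quotient.sound ⟨Functor.leftUnitor _⟩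
  inv_mul_cancel := by
    rintro ⟨e⟩
    exact _root_.Quotient.sound ⟨e.unitIso.symm⟩

variable [Abelian A]

/-- The class of an autoequivalence `e` sends the atom of `H` to the atom of `e(H)`. -/
instance : MulAction (AutoequivClass A) (AtomSpectrum A) where
  smul := _root_.Quotient.map₂ (fun e H => ⟨e.functor.obj H.1, H.2.map_equivalence e⟩) (by
    rintro e f ⟨i⟩ H₁ H₂ h
    exact (HasCommonNonzeroSubobject.map_equivalence h e).mono (𝟙 _) (i.hom.app H₂.1))
  one_smul := by
    rintro ⟨H⟩
    rfl
  mul_smul := by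
    rintro ⟨e⟩ ⟨f⟩ ⟨H⟩
    rfl

lemma mk_smul_atom (e : A ≌ A) (H : A) (hH : Monoform H) :
    AutoequivClass.mk e • atom H hH = atom (e.functor.obj H) (hH.map_equivalence e) := rfl

/-- For a group `G` acting on `A`, where the action is a group homomorphism `φ` from `G` to the
group of isomorphism classes of autoequivalences, two atoms are identified when they lie in the
same orbit of the induced action of `G` on the atom spectrum. -/
def orbitSetoid {G : Type*} [Group G] (φ : G →* AutoequivClass A) : Setoid (AtomSpectrum A) :=
  letI : MulAction G (AtomSpectrum A) := MulAction.compHom (AtomSpectrum A) φ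
  MulAction.orbitRel G (AtomSpectrum A)

/-- The orbit atom spectrum: the set of orbits of `G` in the atom spectrum. -/
def OrbitAtomSpectrum {G : Type*} [Group G] (φ : G →* AutoequivClass A) : Type u :=
  _root_.Quotient (orbitSetoid φ)

/-- The orbit atom spectrum carries the quotient topology. -/
instance {G : Type*} [Group G] (φ : G →* AutoequivClass A) :
    TopologicalSpace (OrbitAtomSpectrum φ) :=
  TopologicalSpace.coinduced (_root_.Quotient.mk (orbitSetoid φ)) inferInstance

end Autoequivalences

/-- A locally noetherian Grothendieck category: a Grothendieck category with a small generating
set of noetherian objects. -/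
class IsLocallyNoetherianGrothendieck (A : Type u) [Category.{v} A] [Abelian A] : Prop
    extends IsGrothendieckAbelian.{w} A where
  exists_noetherian_generators : ∃ P : ObjectProperty A,
    ObjectProperty.Small.{w} P ∧ P.IsSeparating ∧ P ≤ isNoetherianObject

end OrbitAtom

namespace OrbitAtom

section Category

variable {A : Type u} [Category.{v} A]

/-! The saturation of `atomSupport H` is the union of the supports of the translates of `H`, so its
image in the orbit space is open. Hence if orbits `x` and `y` are inseparable, every monoform object
with orbit `x` has a monoform subquotient with orbit `y`, and vice versa. Suppose `x ≠ y`, and let a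
monoform `M` of orbit `x` embed in a quotient `Q` of a noetherian object `P`. Passing from `M` to a
subquotient of orbit `y` and then to one of orbit `x` replaces `Q` by a further quotient
(`IsSubquotient.exists_epi_mono`). This quotient is proper: otherwise the object of orbit `y` would
embed in `M` and have the same atom. So the kernel in `P` grows strictly and can do so forever,
against noetherianity (`orbitMk_ne_of_inseparable`). Noetherian generators supply the initial `P`.
The counterexample is `ℚˣ` acting on `ℝ`, where nonzero orbits are dense. -/

lemma IsSubquotient.of_mono {X M M' : A} (h : IsSubquotient X M) (f : M ⟶ M') [Mono f] :
    IsSubquotient X M' := by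
  obtain ⟨N, i, p, hi, hp⟩ := h
  exact ⟨N, i ≫ f, p, mono_comp i f, hp⟩

lemma IsSubquotient.map_equivalence {X M : A} (h : IsSubquotient X M) (e : A ≌ A) :
    IsSubquotient (e.functor.obj X) (e.functor.obj M) := by
  obtain ⟨N, i, p, hi, hp⟩ := h
  exact ⟨_, e.functor.map i, e.functor.map p, inferInstance, inferInstance⟩

lemma AutoequivClass.mk_symm (e : A ≌ A) :
    AutoequivClass.mk e.symm = (AutoequivClass.mk e)⁻¹ := rfl

lemma AutoequivClass.exists_mk_eq (c : AutoequivClass A) :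
    ∃ e : A ≌ A, AutoequivClass.mk e = c :=
  Quotient.exists_rep c

end Category

/-! ### Monoform objects, subquotients and kernels -/

section Abelian

variable {A : Type u} [Category.{v} A] [Abelian A]

/-- A nonzero subobject of a monoform object is monoform. -/
lemma Monoform.of_mono {H K : A} (hH : Monoform H) (f : K ⟶ H) [Mono f] (hK : ¬ IsZero K) :
    Monoform K := by
  refine ⟨hK, fun L i _ hL hc => hH.2 L (i ≫ f) hL ?_⟩
  -- `K/L` embeds in `H/L`, so a common subobject of `K` and `K/L` is one of `H` and `H/L`.
  suffices Mono (cokernel.map i (i ≫ f) (𝟙 _) f (by simp)) from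
    hc.mono f (cokernel.map i (i ≫ f) (𝟙 _) f _)
  refine Preadditive.mono_of_cancel_zero _ fun {P} g hg => ?_
  obtain ⟨P', π, hπ, g', hg'⟩ := surjective_up_to_refinements_of_epi (cokernel.π i) g
  have h0 : (g' ≫ f) ≫ cokernel.π (i ≫ f) = 0 := by
    have := congrArg (π ≫ ·) hg
    simp only [comp_zero, ← Category.assoc, hg'] at this
    simpa using this
  have h1 : g' = Abelian.monoLift (i ≫ f) (g' ≫ f) h0 ≫ i := by
    rw [← cancel_mono f, Category.assoc, Abelian.monoLift_comp]
  rw [← cancel_epi π, hg', h1]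
  simp

lemma atom_eq_of_mono {H K : A} (hH : Monoform H) (hK : Monoform K) (f : K ⟶ H) [Mono f] :
    atom K hK = atom H hH :=
  _root_.Quotient.sound ⟨K, hK.1, ⟨𝟙 _, inferInstance⟩, ⟨f, inferInstance⟩⟩

lemma atom_mem_atomSupport (H : A) (hH : Monoform H) : atom H hH ∈ atomSupport H :=
  ⟨H, hH, ⟨H, 𝟙 _, 𝟙 _, inferInstance, inferInstance⟩, rfl⟩

lemma atomSupport_subset_of_mono {M M' : A} (f : M ⟶ M') [Mono f] :
    atomSupport M ⊆ atomSupport M' := by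
  rintro _ ⟨H, hH, hs, rfl⟩
  exact ⟨H, hH, hs.of_mono f, rfl⟩

lemma smul_mem_atomSupport (e : A ≌ A) {M : A} {x : AtomSpectrum A} (hx : x ∈ atomSupport M) :
    AutoequivClass.mk e • x ∈ atomSupport (e.functor.obj M) := by
  obtain ⟨H, hH, hs, rfl⟩ := hx
  exact ⟨_, _, hs.map_equivalence e, (mk_smul_atom e H hH).symm⟩

/-- A subquotient `M'` of a subobject of `Q` is a subobject of a quotient of `Q`. -/
lemma IsSubquotient.exists_epi_mono {M' M Q : A} (h : IsSubquotient M' M) (j : M ⟶ Q) [Mono j] :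
    ∃ (Q' : A) (r : Q ⟶ Q') (j' : M' ⟶ Q'), Epi r ∧ Mono j' ∧
      (Mono r → ∃ f : M' ⟶ M, Mono f) := by
  obtain ⟨N, i, p, hi, hp⟩ := h
  -- In an abelian category pushouts preserve both monos and epis. If `r` is mono, the square forces
  -- `p` to be mono, hence an isomorphism, and `M'` embeds in `M` through `N`.
  refine ⟨pushout (i ≫ j) p, pushout.inl _ _, pushout.inr _ _, inferInstance, inferInstance,
    fun hr => ?_⟩
  have : Mono p := by
    have : Mono (p ≫ pushout.inr (i ≫ j) p) := by
      rw [← pushout.condition]; infer_instance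
    exact mono_of_mono p (pushout.inr (i ≫ j) p)
  have : IsIso p := isIso_of_mono_of_epi p
  exact ⟨inv p ≫ i, inferInstance⟩

/-- If the kernels agreed, a map killed by `r` would lift along `q`, after an epimorphic cover, to a
map into the kernel of `q`, and so would vanish. -/
lemma kernelSubobject_lt_comp {X Y Z : A} (q : X ⟶ Y) [Epi q] (r : Y ⟶ Z) (hr : ¬ Mono r) :
    kernelSubobject q < kernelSubobject (q ≫ r) := by
  refine lt_of_le_not_ge (le_kernelSubobject _ _ (by simp)) fun hle => hr ?_
  refine Preadditive.mono_of_cancel_zero _ fun {P} g hg => ?_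
  obtain ⟨P', π, hπ, g', hg'⟩ := surjective_up_to_refinements_of_epi q g
  have h0 : g' ≫ q ≫ r = 0 := by
    rw [← Category.assoc, ← hg', Category.assoc, hg, comp_zero]
  have h1 := (kernelSubobject_factors_iff q g').1
    (Subobject.factors_of_le g' hle (kernelSubobject_factors _ _ h0))
  rw [← cancel_epi π, hg', h1, comp_zero]

/-- Every nonzero object has a nonzero subobject that is a quotient of a noetherian object. -/
lemma exists_noetherian_epi_mono [IsLocallyNoetherianGrothendieck.{w} A] {H : A}
    (hH : ¬ IsZero H) :
    ∃ (P K : A) (q : P ⟶ K) (i : K ⟶ H), IsNoetherianObject P ∧ Epi q ∧ Mono i ∧ ¬ IsZero K := by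
  obtain ⟨P, -, hs, hn⟩ :=
    IsLocallyNoetherianGrothendieck.exists_noetherian_generators.{w} (A := A)
  by_contra! hc
  -- If every image in `H` of a generator were zero, the separating family could not tell `𝟙 H` from
  -- `0`.
  refine hH ((IsZero.iff_id_eq_zero H).2 (hs _ _ fun X hX h => ?_))
  have hz := hc X (image h) (factorThruImage h) (image.ι h) ⟨hn X hX⟩ inferInstance inferInstance
  have : h = 0 := by rw [← image.fac h, hz.eq_of_src (image.ι h) 0, comp_zero]
  rw [this, zero_comp, zero_comp]

end Abelian

/-! ### Orbits of atoms and the noetherian argument -/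

section Orbits

variable {A : Type u} [Category.{v} A] [Abelian A] {G : Type z} [Group G]
  (φ : G →* AutoequivClass A)

/-- The orbit of an atom. -/
def orbitMk (x : AtomSpectrum A) : OrbitAtomSpectrum φ := _root_.Quotient.mk (orbitSetoid φ) x

lemma orbitMk_eq_iff {x y : AtomSpectrum A} :
    orbitMk φ x = orbitMk φ y ↔ ∃ g : G, φ g • y = x :=
  _root_.Quotient.eq (r := orbitSetoid φ)

lemma orbitMk_smul (g : G) (x : AtomSpectrum A) : orbitMk φ (φ g • x) = orbitMk φ x :=
  (orbitMk_eq_iff φ).2 ⟨g, rfl⟩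

/-- The image of an atom support in the orbit atom spectrum is open. -/
lemma isOpen_image_atomSupport (H : A) : IsOpen (orbitMk φ '' atomSupport H) := by
  have : orbitMk φ ⁻¹' (orbitMk φ '' atomSupport H) =
      ⋃ e : {e : A ≌ A // AutoequivClass.mk e ∈ φ.range}, atomSupport (e.1.functor.obj H) := by
    ext x
    simp only [Set.mem_preimage, Set.mem_image, Set.mem_iUnion, Subtype.exists]
    constructor
    · rintro ⟨y, hy, hyx⟩
      obtain ⟨g, rfl⟩ := (orbitMk_eq_iff φ).1 hyx.symm
      obtain ⟨e, he⟩ := AutoequivClass.exists_mk_eq (φ g)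
      exact ⟨e, ⟨g, he.symm⟩, he ▸ smul_mem_atomSupport e hy⟩
    · rintro ⟨e, ⟨g, hg⟩, hx⟩
      refine ⟨φ g⁻¹ • x, ?_, orbitMk_smul φ _ _⟩
      rw [map_inv, hg, ← AutoequivClass.mk_symm]
      exact atomSupport_subset_of_mono (e.unitInv.app H) (smul_mem_atomSupport e.symm hx)
  refine isOpen_coinduced.2 ?_
  change IsOpen (orbitMk φ ⁻¹' (orbitMk φ '' atomSupport H))
  rw [this]
  exact isOpen_iUnion fun e => TopologicalSpace.isOpen_generateFrom_of_mem ⟨_, rfl⟩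

/-- Topologically indistinguishable orbits meet the supports of each other's monoform objects. -/
lemma exists_subquotient_of_inseparable {x y : OrbitAtomSpectrum φ} (h : Inseparable x y)
    {M : A} (hM : Monoform M) (hx : orbitMk φ (atom M hM) = x) :
    ∃ (M' : A) (hM' : Monoform M'), IsSubquotient M' M ∧ orbitMk φ (atom M' hM') = y := by
  have hy := (h.mem_open_iff (isOpen_image_atomSupport φ M)).1
    (hx ▸ ⟨_, atom_mem_atomSupport M hM, rfl⟩)
  obtain ⟨_, ⟨M', hM', hs, rfl⟩, hy⟩ := hy
  exact ⟨M', hM', hs, hy⟩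

/-- Distinct orbits that meet the supports of each other's monoform objects do not occur in
a quotient of a noetherian object. -/
lemma orbitMk_ne_of_inseparable {x y : OrbitAtomSpectrum φ} (h : Inseparable x y) (hxy : x ≠ y)
    {P : A} [IsNoetherianObject P] (S : Subobject P) :
    ∀ {Q M : A} (q : P ⟶ Q) [Epi q] (j : M ⟶ Q) [Mono j] (hM : Monoform M),
      kernelSubobject q = S → orbitMk φ (atom M hM) ≠ x := by
  induction S using WellFoundedGT.induction with
  | ind S ih =>
  intro Q M q _ j _ hM hS hx
  -- Two steps, `x` to `y` and back to `x`, so that the induction hypothesis applies to `M₂`.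
  obtain ⟨M₁, hM₁, hs₁, hy⟩ := exists_subquotient_of_inseparable φ h hM hx
  obtain ⟨M₂, hM₂, hs₂, hx₂⟩ := exists_subquotient_of_inseparable φ h.symm hM₁ hy
  obtain ⟨Q₁, r₁, j₁, _, _, hr₁⟩ := hs₁.exists_epi_mono j
  obtain ⟨Q₂, r₂, j₂, _, _, -⟩ := hs₂.exists_epi_mono j₁
  refine ih _ ?_ (q ≫ r₁ ≫ r₂) j₂ hM₂ rfl hx₂
  rw [← hS]
  -- Were `r₁ ≫ r₂` mono, `r₁` would be mono too, so `M₁` would embed in `M` and `x = y`.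
  refine kernelSubobject_lt_comp q _ fun _ => hxy ?_
  obtain ⟨f, _⟩ := hr₁ (mono_of_mono r₁ r₂)
  rw [← hx, ← hy, atom_eq_of_mono hM hM₁ f]

theorem t0Space_orbitAtomSpectrum [IsLocallyNoetherianGrothendieck.{w} A] :
    T0Space (OrbitAtomSpectrum φ) := by
  refine ⟨fun x y h => by_contra fun hxy => ?_⟩
  obtain ⟨⟨H, hH⟩, rfl⟩ : ∃ H : {H : A // Monoform H}, orbitMk φ (atom H.1 H.2) = x := by
    obtain ⟨⟨H⟩, rfl⟩ := _root_.Quotient.exists_rep x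
    exact ⟨H, rfl⟩
  obtain ⟨P, K, q, i, _, _, _, hK⟩ := exists_noetherian_epi_mono.{w} hH.1
  have hK' := hH.of_mono i hK
  exact orbitMk_ne_of_inseparable φ h hxy _ q (𝟙 K) hK' rfl
    (by rw [atom_eq_of_mono hH hK' i])

end Orbits

/-! ### A quotient of `ℝ` that is not T₀ -/

/-- The orbit of a nonzero real number under multiplication by nonzero rationals is dense. -/
lemma exists_units_rat_smul_mem {x : ℝ} (hx : x ≠ 0) {U : Set ℝ} (hU : IsOpen U)
    {y : ℝ} (hy : y ∈ U) (hy0 : y ≠ 0) : ∃ q : ℚˣ, q • x ∈ U := by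
  -- Removing `0` from `U` forces the rational found below to be nonzero, hence a unit.
  have hV : IsOpen ((fun t : ℝ => t * x) ⁻¹' (U ∩ {0}ᶜ)) :=
    (hU.inter isOpen_compl_singleton).preimage (by fun_prop)
  obtain ⟨q, hqU, hq0⟩ := Rat.denseRange_cast.exists_mem_open hV
    ⟨y / x, by simpa [hx] using ⟨hy, hy0⟩⟩
  have hq : q ≠ 0 := by
    rintro rfl
    simp at hq0
  exact ⟨Units.mk0 q hq, by simpa [Units.smul_def, Rat.smul_def] using hqU⟩

/-- By density, every open set of orbits containing one nonzero orbit contains them all. The orbits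
of `√2` and `1` are thus inseparable, yet distinct because `√2` is irrational. -/
lemma not_t0Space_real_quotient_units_rat :
    ¬ T0Space (MulAction.orbitRel.Quotient ℚˣ ℝ) := by
  intro h
  have key : ∀ {x y : ℝ}, x ≠ 0 → y ≠ 0 → ∀ s : Set (MulAction.orbitRel.Quotient ℚˣ ℝ),
      IsOpen s → (Quotient.mk _ y : MulAction.orbitRel.Quotient ℚˣ ℝ) ∈ s →
        (Quotient.mk _ x : MulAction.orbitRel.Quotient ℚˣ ℝ) ∈ s := by
    intro x y hx hy s hs hys
    obtain ⟨q, hq⟩ := exists_units_rat_smul_mem hx (hs.preimage continuous_quotient_mk') hys hy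
    have : (Quotient.mk _ (q • x) : MulAction.orbitRel.Quotient ℚˣ ℝ) = Quotient.mk _ x :=
      Quotient.sound ⟨q, rfl⟩
    exact this ▸ hq
  have h2 : √2 ≠ 0 := by positivity
  have heq : (Quotient.mk _ √2 : MulAction.orbitRel.Quotient ℚˣ ℝ) = Quotient.mk _ 1 :=
    h.t0 (inseparable_iff_forall_isOpen.2 fun s hs =>
      ⟨key one_ne_zero h2 s hs, key h2 one_ne_zero s hs⟩)
  obtain ⟨q, hq⟩ := Quotient.exact heq
  refine irrational_sqrt_two ⟨q, ?_⟩
  simpa [Units.smul_def, Rat.smul_def] using hq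

end OrbitAtom

theorem mainTheorem9 (A : Type u) [Category.{v} A] [Abelian A]
    [OrbitAtom.IsLocallyNoetherianGrothendieck.{w} A]
    (G : Type z) [Group G] (φ : G →* OrbitAtom.AutoequivClass A) :
    T0Space (OrbitAtom.OrbitAtomSpectrum φ) ∧
    (∃ (X : Type) (_ : TopologicalSpace X) (H : Type) (_ : Group H) (_ : MulAction H X),
      T0Space X ∧ ContinuousConstSMul H X ∧
        ¬ T0Space (MulAction.orbitRel.Quotient H X)) :=
  ⟨OrbitAtom.t0Space_orbitAtomSpectrum.{w} φ, ℝ, inferInstance, ℚˣ, inferInstance, inferInstance,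
    inferInstance, inferInstance, OrbitAtom.not_t0Space_real_quotient_units_rat⟩
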